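/- **Setting.** Let $D\ge 1$. For a density $f$ on $\mathbb R^D$, a *mode* of $f$ is a point $x$ with $f(x')\le f(x)$ for all $x'\in\mathbb R^D$. Call a probability density $f$ on $\mathbb R^D$ *unimodal* if it has exactly one mode $\mathrm{mode}(f)$, $f$ is twice differentiable in a neighbourhood of $\mathrm{mode}(f)$ with negative definite Hessian there, $f$ vanishes off some closed set on which it is continuous, and $f(x)\to 0$ as $|x|\to\infty$. There are $K\ge 2$ arms. Arm $i$ yields i.i.d. samples (independent across arms) from a unimodal density $f_i$ on $\mathbb R^D$. Let $r:\mathbb R^D\to[0,1]$ be an $L$-Lipschitz score function (for densities supported in $[0,1]$, $D=1$, one may take $r(x)=x$ on $[0,1]$). Put $\theta_i=r(\mathrm{mode}(f_i))$, let the arms be indexed so that $\theta_1\ge\theta_2\ge\dots\ge\theta_K$, and put $\Delta_i=\theta_1-\theta_i$. **Mode estimator.** For a sample $S=\{x_1,\dots,x_s\}$ put $k=s^{4/(4+D)}$ and $r_k(x)=\inf\{\rho: |B(x,\rho)\cap S|\ge k\}$, and let $\widehat{\mathrm{mode}}(S)$ be a minimizer of $r_k$ over $S$. **Modal UCB strategy**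 with $n$ time steps and confidence parameter $\delta'$. Let $T_i(t)$ be the number of pulls of arm $i$ up to time $t$ and $S_i(t)$ the set of the samples observed from arm $i$ up to time $t$. At each time $t=1,\dots,n$ pull an arm $I_t$ that maximizes $$r\big(\widehat{\mathrm{mode}}(S_i(t-1))\big)+\frac{\log(1/\delta')\,\log T_i(t-1)}{T_i(t-1)^{1/(4+D)}},$$ where this index is $+\infty$ if $T_i(t-1)\le 1$ (so each arm is first pulled twice). All ties, in the mode estimator and in the choice of the arm, are broken arbitrarily. **Theorem (Top arm identification).** There is a polynomial $P$ in two variables, depending only on $D$, and, for every $L\ge 0$, an assignment of a constant $N_f\in\mathbb N$ to each $f$, depending only on $f$, $D$ and $L$, such that the following holds in the above setting for all $K$, $r$, $f_1,\dots,f_K$ with $\theta_1>\theta_2$ and all $0<\delta<1$. If $$n\ \ge\ P\Big(\log\tfrac1\delta,\ \log\sum_{i=2}^K\Delta_i^{-(4+D)}\Big)\cdot\sum_{i=2}^K\Delta_i^{-(4+D)}\qquad\text{and}\qquad n\ge \max_{1\le i\le K}N_{f_i},$$ then the modal UCB strategy with $n$ time steps and confidence parameter $\delta/n$ satisfies $$\mathbb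 P\Big(|\{t\le n: I_t=1\}|>|\{t\le n: I_t=i\}|\ \text{ for all } i\ne 1\Big)\ \ge\ 1-\delta .$$ -/

import Mathlib

open MeasureTheory ProbabilityTheory Filter Topology

namespace ModalBandit

/-- `x` is a mode of `f` if `f` attains its global maximum at `x`. -/
def IsMode {D : ℕ} (f : EuclideanSpace ℝ (Fin D) → ℝ) (x : EuclideanSpace ℝ (Fin D)) : Prop :=
  ∀ x', f x' ≤ f x

/-- `mode(f)`, the mode of a density that has one. -/
noncomputable def modeOf {D : ℕ} (f : EuclideanSpace ℝ (Fin D) → ℝ) : EuclideanSpace ℝ (Fin D) :=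
  Classical.epsilon (IsMode f)

/-- Unimodal probability densities on `ℝ^D` with the modal structure assumption: there is exactly
one mode, around it `f` is twice differentiable, and the Hessian there is negative definite.
The domain `𝒳` of the density is a closed set on which `f` is continuous (it may jump to `0` at
the boundary of `𝒳`), and `f` vanishes at infinity (automatic when `𝒳` is compact). -/
structure IsUnimodalDensity {D : ℕ} (f : EuclideanSpace ℝ (Fin D) → ℝ) : Prop where
  measurable : Measurable f
  nonneg : ∀ x, 0 ≤ f x
  lintegral_eq_one : ∫⁻ x, ENNReal.ofReal (f x) = 1
  continuousOn_domain : ∃ 𝒳 : Set (EuclideanSpace ℝ (Fin D)),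
    IsClosed 𝒳 ∧ ContinuousOn f 𝒳 ∧ ∀ x, x ∉ 𝒳 → f x = 0
  vanishes : Tendsto f (cocompact (EuclideanSpace ℝ (Fin D))) (𝓝 0)
  unimodal : ∃! x, IsMode f x
  twice_differentiable : ∀ x, IsMode f x →
    ∀ᶠ y in 𝓝 x, DifferentiableAt ℝ f y ∧ DifferentiableAt ℝ (fderiv ℝ f) y
  hessian_neg : ∀ x, IsMode f x → ∀ v, v ≠ 0 → fderiv ℝ (fderiv ℝ f) x v v < 0

/-- The probability distribution on `ℝ^D` with density `f`. -/
noncomputable def lawOf {D : ℕ} (f : EuclideanSpace ℝ (Fin D) → ℝ) :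
    Measure (EuclideanSpace ℝ (Fin D)) :=
  volume.withDensity (fun x => ENNReal.ofReal (f x))

/-- `r_k(x)`: the infimum of the radii `ρ` for which the ball `B(x, ρ)` holds at least `k` of the
sample points `S 0, …, S (s - 1)`. -/
noncomputable def knnRadius {D s : ℕ} (k : ℝ) (S : Fin s → EuclideanSpace ℝ (Fin D))
    (x : EuclideanSpace ℝ (Fin D)) : ℝ :=
  sInf {ρ : ℝ | k ≤ (Nat.card {j : Fin s // dist (S j) x ≤ ρ} : ℝ)}

/-- `x` is a possible output of the mode estimator on the sample `S` of size `s`: a sample point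
that minimizes `r_k` over the sample, for `k = s ^ (4 / (4 + D))`. Ties are broken arbitrarily. -/
def IsModeEstimate {D s : ℕ} (S : Fin s → EuclideanSpace ℝ (Fin D))
    (x : EuclideanSpace ℝ (Fin D)) : Prop :=
  ∃ j, x = S j ∧ ∀ j', knnRadius ((s : ℝ) ^ ((4 : ℝ) / (4 + D))) S (S j) ≤
    knnRadius ((s : ℝ) ^ ((4 : ℝ) / (4 + D))) S (S j')

/-- `T_i(t)`: the number of times arm `i` is pulled at the times `1, …, t`. -/
def pulls {K : ℕ} (I : ℕ → Fin K) (i : Fin K) (t : ℕ) : ℕ :=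
  ((Finset.Icc 1 t).filter (fun u => I u = i)).card

/-- The upper confidence bound of an arm that has been pulled `T` times and whose estimated score
is `v`, for confidence parameter `δ`. It is `+∞` for `T ≤ 1`, where the band is undefined
(`T = 0`) or degenerates to width `log 1 = 0` (`T = 1`). -/
noncomputable def ucbIndex (D : ℕ) (δ : ℝ) (T : ℕ) (v : ℝ) : EReal :=
  if T ≤ 1 then ⊤
  else ((v + Real.log (1 / δ) * Real.log T / (T : ℝ) ^ ((1 : ℝ) / (4 + D)) : ℝ) : EReal)

/-- `I 1, …, I n` is a run of the modal UCB strategy with total time `n` and confidence parameter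
`δ`, when the `(j + 1)`-st pull of arm `i` returns `X i j`: the estimate `est i t` is computed from
the rewards of arm `i` observed up to time `t`, and each pull maximizes the upper confidence bound.
All ties are broken arbitrarily. -/
def IsUCBRun {D K : ℕ} (r : EuclideanSpace ℝ (Fin D) → ℝ) (n : ℕ) (δ : ℝ)
    (X : Fin K → ℕ → EuclideanSpace ℝ (Fin D)) (I : ℕ → Fin K) : Prop :=
  ∃ est : Fin K → ℕ → EuclideanSpace ℝ (Fin D),
    (∀ i t, 1 ≤ pulls I i t →
      IsModeEstimate (fun j : Fin (pulls I i t) => X i j) (est i t)) ∧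
    ∀ t, t < n → ∀ i,
      ucbIndex D δ (pulls I i t) (r (est i t)) ≤
        ucbIndex D δ (pulls I (I (t + 1)) t) (r (est (I (t + 1)) t))

/-- `∑_{i ≠ a} Δ_i^{-(4 + D)}` with `Δ_i = θ_a - θ_i`, where `a` is the best arm. -/
noncomputable def gapSum {K : ℕ} (D : ℕ) (θ : Fin K → ℝ) (a : Fin K) : ℝ :=
  ∑ i ∈ Finset.univ.erase a, ((θ a - θ i) ^ (4 + D))⁻¹

end ModalBandit

/-!
The mode estimator built on `s` samples errs by at most `ℓ * s ^ (-1 / (4 + D))`, up to a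
probability of order `s * exp (-5 * ℓ)`, once `ℓ` is large and this error is small
(`IsUnimodalDensity.exists_pi_modeEstimate_le`). Near its mode the density lies between two concave
paraboloids, and elsewhere it stays a fixed amount below its maximum, so at distance `ε` from the
mode a ball of small radius `ρ` has less mass than a ball near the mode by a relative amount of
order `ε ^ 2`. For the radius at which a ball near the mode is expected to hold slightly more than
`k = s ^ (4 / (4 + D))` sample points, Chernoff bounds show that all sample points near the mode
have `k` neighbours within `ρ` and no sample point at distance more than `ε` does. The centres of the
balls are sample points themselves; since each is independent of the others, integrating over one
coordinate of the product measure (`pi_leaveOneOut_le`) reduces this to balls with a fixed centre.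

The confidence band exceeds this error, times the Lipschitz constant of the score, by the factor
`log s` over a constant. Where the band is wider than `1` it holds trivially, and elsewhere `s` is
large because `ℓ = log (n / δ)` is, so that `log s` absorbs every constant depending on `f` and `L`
(`IsUnimodalDensity.exists_pi_score_band_le`). A union bound makes all bands valid together with
probability at least `1 - δ`.

When all bands are valid, an arm with gap `Δ` is pulled at most
`(2 * ℓ * log n) ^ (4 + D) * Δ ^ (-(4 + D)) + 2` times (`IsUCBRun.pulls_le`). The sum of these
bounds over the suboptimal arms is less than `n / 2` once `n` is at least a polynomial in the logarithms
times `∑ Δ ^ (-(4 + D))` (`exists_polynomial_horizon`), so the best arm is pulled more than `n / 2`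
times.
-/

namespace ModalBandit

/-! ### Quadratic bounds for a unimodal density around its mode -/

section LocalQuadratic

variable {E : Type*} [NormedAddCommGroup E] [NormedSpace ℝ E] {f : E → ℝ} {x₀ : E}

lemma exists_quadratic_lower_bound (hmax : IsLocalMax f x₀)
    (hf : ∀ᶠ y in 𝓝 x₀, DifferentiableAt ℝ f y) (hf' : DifferentiableAt ℝ (fderiv ℝ f) x₀) :
    ∃ C > 0, ∃ r > 0, ∀ x, dist x x₀ < r → f x₀ - C * dist x x₀ ^ 2 ≤ f x := by
  have h0 : fderiv ℝ f x₀ = 0 := hmax.fderiv_eq_zero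
  obtain ⟨C, hC, hb⟩ := (hf'.hasFDerivAt.isBigO_sub).exists_pos
  obtain ⟨r, hr, hball⟩ := Metric.eventually_nhds_iff.1 (hf.and hb.bound)
  refine ⟨C, hC, r, hr, fun x hx => ?_⟩
  have key : ‖f x - f x₀‖ ≤ (C * dist x x₀) * ‖x - x₀‖ := by
    refine (convex_closedBall x₀ (dist x x₀)).norm_image_sub_le_of_norm_fderiv_le (𝕜 := ℝ)
      (fun y hy => (hball (lt_of_le_of_lt hy hx)).1) (fun y hy => ?_)
      (Metric.mem_closedBall_self dist_nonneg) (Metric.mem_closedBall.2 le_rfl)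
    have h1 := (hball (lt_of_le_of_lt hy hx)).2
    rw [h0, sub_zero, ← dist_eq_norm] at h1
    exact h1.trans (by gcongr; exact hy)
  rw [Real.norm_eq_abs, ← dist_eq_norm] at key
  nlinarith [neg_abs_le (f x - f x₀)]

/-- A twice differentiable function lies below a strictly concave paraboloid near a critical point
with negative definite Hessian: along each segment from the critical point, the derivative is at
most `-c t ‖v‖ ^ 2`. -/
lemma exists_local_quadratic_upper_bound [FiniteDimensional ℝ E] (hmax : IsLocalMax f x₀)
    (hf : ∀ᶠ y in 𝓝 x₀, DifferentiableAt ℝ f y) (hf' : DifferentiableAt ℝ (fderiv ℝ f) x₀)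
    (hneg : ∀ v, v ≠ 0 → fderiv ℝ (fderiv ℝ f) x₀ v v < 0) :
    ∃ c > 0, ∃ r > 0, ∀ x, dist x x₀ < r → f x ≤ f x₀ - c * dist x x₀ ^ 2 := by
  have h0 : fderiv ℝ f x₀ = 0 := hmax.fderiv_eq_zero
  set H := fderiv ℝ (fderiv ℝ f) x₀ with hH
  have : ProperSpace E := FiniteDimensional.proper ℝ E
  obtain ⟨a, ha, hsph⟩ : ∃ a, 0 < a ∧ ∀ v ∈ Metric.sphere (0 : E) 1, a ≤ -(H v v) := by
    refine (isCompact_sphere (0 : E) 1).exists_forall_le' (by fun_prop) fun v hv => ?_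
    have : v ≠ 0 := by
      rintro rfl
      simp at hv
    linarith [hneg v this]
  have hquad : ∀ v, H v v ≤ -a * ‖v‖ ^ 2 := by
    intro v
    rcases eq_or_ne v 0 with rfl | hv
    · simp
    have hv' : 0 < ‖v‖ := norm_pos_iff.2 hv
    have h1 := hsph (‖v‖⁻¹ • v) (by simp [norm_smul, hv'.ne'])
    simp only [map_smul, smul_apply, smul_eq_mul] at h1
    have h2 : ‖v‖ ^ 2 * a ≤ ‖v‖ ^ 2 * -(‖v‖⁻¹ * (‖v‖⁻¹ * H v v)) := by gcongr
    have h3 : ‖v‖ ^ 2 * -(‖v‖⁻¹ * (‖v‖⁻¹ * H v v)) = -(H v v) := by field_simp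
    linarith
  have hlo := hf'.hasFDerivAt.isLittleO.bound (half_pos ha)
  obtain ⟨r, hr, hball⟩ := Metric.eventually_nhds_iff.1 (hf.and hlo)
  refine ⟨a / 4, by positivity, r, hr, fun x hx => ?_⟩
  set v := x - x₀ with hv
  have hvr : ‖v‖ < r := by rwa [hv, ← dist_eq_norm]
  have hmem : ∀ t ∈ Set.Icc (0 : ℝ) 1, dist (x₀ + t • v) x₀ < r := by
    intro t ht
    rw [dist_eq_norm, add_sub_cancel_left, norm_smul, Real.norm_eq_abs, abs_of_nonneg ht.1]
    nlinarith [norm_nonneg v, ht.2]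
  have hder : ∀ t ∈ Set.Icc (0 : ℝ) 1,
      HasDerivAt (fun t : ℝ => f (x₀ + t • v) + a / 4 * ‖v‖ ^ 2 * t ^ 2)
      (fderiv ℝ f (x₀ + t • v) v + a / 4 * ‖v‖ ^ 2 * (2 * t)) t := by
    intro t ht
    have h1 : HasDerivAt (fun t : ℝ => x₀ + t • v) v t := by
      simpa using ((hasDerivAt_id t).smul_const v).const_add x₀
    have h2 := (hball (hmem t ht)).1.hasFDerivAt.comp_hasDerivAt t h1
    have h3 : HasDerivAt (fun t : ℝ => t ^ 2) (2 * t) t := by simpa using hasDerivAt_pow 2 t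
    exact h2.add (h3.const_mul _)
  have hanti : AntitoneOn (fun t : ℝ => f (x₀ + t • v) + a / 4 * ‖v‖ ^ 2 * t ^ 2)
      (Set.Icc (0 : ℝ) 1) := by
    refine antitoneOn_of_deriv_nonpos (convex_Icc 0 1)
      (fun t ht => (hder t ht).continuousAt.continuousWithinAt)
      (fun t ht => (hder t (interior_subset ht)).differentiableAt.differentiableWithinAt)
      fun t ht => ?_
    rw [(hder t (interior_subset ht)).deriv]
    rw [interior_Icc] at ht
    have h1 := (hball (hmem t ⟨ht.1.le, ht.2.le⟩)).2
    rw [h0, sub_zero, add_sub_cancel_left] at h1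
    have h2 : fderiv ℝ f (x₀ + t • v) v - H (t • v) v ≤ a / 2 * ‖t • v‖ * ‖v‖ := by
      refine (le_abs_self _).trans ?_
      have := (fderiv ℝ f (x₀ + t • v) - H (t • v)).le_opNorm v
      rw [sub_apply, Real.norm_eq_abs] at this
      exact this.trans (by gcongr)
    have h3 : H (t • v) v = t * H v v := by simp
    rw [norm_smul, Real.norm_eq_abs, abs_of_pos ht.1, h3] at h2
    nlinarith [mul_le_mul_of_nonneg_left (hquad v) ht.1.le, ht.1]
  have := hanti (Set.left_mem_Icc.2 zero_le_one) (Set.right_mem_Icc.2 zero_le_one) zero_le_one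
  simp only [one_smul, zero_smul, add_zero] at this
  rw [hv, add_sub_cancel, ← hv] at this
  rw [dist_eq_norm, ← hv]
  linarith

end LocalQuadratic

namespace IsUnimodalDensity

variable {D : ℕ} {f : EuclideanSpace ℝ (Fin D) → ℝ}

lemma isMode_modeOf (hf : IsUnimodalDensity f) : IsMode f (modeOf f) :=
  Classical.epsilon_spec hf.unimodal.exists

lemma mode_pos (hf : IsUnimodalDensity f) : 0 < f (modeOf f) := by
  by_contra! h
  have h0 : ∀ x, f x = 0 := fun x => le_antisymm ((hf.isMode_modeOf x).trans h) (hf.nonneg x)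
  have := hf.lintegral_eq_one
  simp [h0] at this

lemma isLocalMax (hf : IsUnimodalDensity f) : IsLocalMax f (modeOf f) :=
  Eventually.of_forall hf.isMode_modeOf

/-- Away from its mode a unimodal density stays below its maximum by a fixed amount: at infinity and
off the domain it is small, and on the rest of the domain, a compact set, it attains a maximum,
which is not the global one. -/
lemma exists_gap_of_dist_ge (hf : IsUnimodalDensity f) {r : ℝ} (hr : 0 < r) :
    ∃ η > 0, ∀ x, r ≤ dist x (modeOf f) → f x ≤ f (modeOf f) - η := by
  set x₀ := modeOf f
  have hpos : 0 < f x₀ := hf.mode_pos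
  obtain ⟨S, hS, hcont, hoff⟩ := hf.continuousOn_domain
  have hev := hf.vanishes.eventually (gt_mem_nhds (half_pos hpos))
  obtain ⟨Q, hQ, hQf⟩ := mem_cocompact.1 hev
  have hcomp : IsCompact (Q ∩ (S ∩ {x | r ≤ dist x x₀})) :=
    hQ.inter_right (hS.inter (isClosed_le continuous_const (by fun_prop)))
  obtain ⟨a, ha, hle⟩ : ∃ a, 0 < a ∧ ∀ x ∈ Q ∩ (S ∩ {x | r ≤ dist x x₀}), a ≤ f x₀ - f x := by
    refine hcomp.exists_forall_le' (f := fun x => f x₀ - f x)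
      (continuousOn_const.sub (hcont.mono fun x hx => hx.2.1)) ?_
    rintro x ⟨-, -, hx : r ≤ dist x x₀⟩
    rcases (hf.isMode_modeOf x).lt_or_eq with h | h
    · exact sub_pos.2 h
    · have hm : IsMode f x := fun y => h ▸ hf.isMode_modeOf y
      have : x = x₀ := hf.unimodal.unique hm hf.isMode_modeOf
      rw [this, dist_self] at hx
      linarith
  refine ⟨min a (f x₀ / 2), by positivity, fun x hx => ?_⟩
  by_cases hxQ : x ∈ Q
  · by_cases hxS : x ∈ S
    · linarith [hle x ⟨hxQ, hxS, hx⟩, min_le_left a (f x₀ / 2)]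
    · linarith [hoff x hxS, min_le_right a (f x₀ / 2)]
  · have : f x < f x₀ / 2 := hQf hxQ
    linarith [min_le_right a (f x₀ / 2)]

lemma exists_lower_bound (hf : IsUnimodalDensity f) :
    ∃ C > 0, ∃ r > 0, ∀ x, dist x (modeOf f) < r →
      f (modeOf f) - C * dist x (modeOf f) ^ 2 ≤ f x :=
  have h := hf.twice_differentiable _ hf.isMode_modeOf
  exists_quadratic_lower_bound hf.isLocalMax (h.mono fun _ hy => hy.1) h.self_of_nhds.2

lemma exists_upper_bound (hf : IsUnimodalDensity f) :
    ∃ c > 0, ∃ r > 0, ∀ ε, 0 < ε → ε ≤ r → ∀ x, ε ≤ dist x (modeOf f) →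
      f x ≤ f (modeOf f) - c * ε ^ 2 := by
  have h := hf.twice_differentiable _ hf.isMode_modeOf
  obtain ⟨c, hc, r, hr, hloc⟩ := exists_local_quadratic_upper_bound hf.isLocalMax
    (h.mono fun _ hy => hy.1) h.self_of_nhds.2 (hf.hessian_neg _ hf.isMode_modeOf)
  obtain ⟨η, hη, hfar⟩ := hf.exists_gap_of_dist_ge hr
  refine ⟨min c (η / r ^ 2), by positivity, r, hr, fun ε hε hεr x hx => ?_⟩
  rcases lt_or_ge (dist x (modeOf f)) r with hlt | hge
  · have h1 : min c (η / r ^ 2) * ε ^ 2 ≤ c * dist x (modeOf f) ^ 2 := by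
      gcongr
      exact min_le_left _ _
    linarith [hloc x hlt]
  · have h1 : min c (η / r ^ 2) * ε ^ 2 ≤ η / r ^ 2 * r ^ 2 := by
      gcongr
      exact min_le_right _ _
    rw [div_mul_cancel₀ _ (by positivity)] at h1
    linarith [hfar x hge]

end IsUnimodalDensity

/-! ### Mass of small balls -/

section BallMass

variable {D : ℕ} {f : EuclideanSpace ℝ (Fin D) → ℝ}

lemma IsUnimodalDensity.isProbabilityMeasure_lawOf (hf : IsUnimodalDensity f) :
    IsProbabilityMeasure (lawOf f) :=
  ⟨by rw [lawOf, withDensity_apply _ MeasurableSet.univ, Measure.restrict_univ,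
    hf.lintegral_eq_one]⟩

/-- The volume of the unit ball of `ℝ^D`. -/
noncomputable def unitBallVolume (D : ℕ) : ℝ :=
  volume.real (Metric.ball (0 : EuclideanSpace ℝ (Fin D)) 1)

lemma unitBallVolume_pos (D : ℕ) : 0 < unitBallVolume D :=
  ENNReal.toReal_pos (Metric.measure_ball_pos volume _ one_pos).ne' measure_ball_lt_top.ne

lemma volume_real_closedBall (x : EuclideanSpace ℝ (Fin D)) {ρ : ℝ} (hρ : 0 ≤ ρ) :
    volume.real (Metric.closedBall x ρ) = ρ ^ D * unitBallVolume D := by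
  rw [Measure.addHaar_real_closedBall _ _ hρ, finrank_euclideanSpace_fin, unitBallVolume]

lemma lawOf_real_closedBall_le {x : EuclideanSpace ℝ (Fin D)} {ρ M : ℝ}
    (hρ : 0 ≤ ρ) (hM : 0 ≤ M) (h : ∀ y ∈ Metric.closedBall x ρ, f y ≤ M) :
    (lawOf f).real (Metric.closedBall x ρ) ≤ M * (ρ ^ D * unitBallVolume D) := by
  rw [← volume_real_closedBall x hρ]
  refine ENNReal.toReal_le_of_le_ofReal (by positivity) ?_
  rw [lawOf, withDensity_apply _ measurableSet_closedBall, ENNReal.ofReal_mul hM,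
    ofReal_measureReal measure_closedBall_lt_top.ne, ← setLIntegral_const]
  exact setLIntegral_mono measurable_const fun y hy => ENNReal.ofReal_le_ofReal (h y hy)

lemma le_lawOf_real_closedBall (hf : IsUnimodalDensity f) {x : EuclideanSpace ℝ (Fin D)} {ρ M : ℝ}
    (hρ : 0 ≤ ρ) (hM : 0 ≤ M) (h : ∀ y ∈ Metric.closedBall x ρ, M ≤ f y) :
    M * (ρ ^ D * unitBallVolume D) ≤ (lawOf f).real (Metric.closedBall x ρ) := by
  have := hf.isProbabilityMeasure_lawOf
  rw [← volume_real_closedBall x hρ]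
  refine (ENNReal.ofReal_le_iff_le_toReal (measure_ne_top _ _)).1 ?_
  rw [lawOf, withDensity_apply _ measurableSet_closedBall, ENNReal.ofReal_mul hM,
    ofReal_measureReal measure_closedBall_lt_top.ne, ← setLIntegral_const]
  exact setLIntegral_mono hf.measurable.ennreal_ofReal fun y hy => ENNReal.ofReal_le_ofReal (h y hy)

end BallMass

/-! ### Chernoff bounds for the number of points in a set -/

section Chernoff

variable {E : Type*} {m : ℕ}

/-- The number of entries of the tuple `y` that lie in `A`, as a real number. -/
noncomputable def hitCount (A : Set E) (y : Fin m → E) : ℝ :=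
  ∑ l, A.indicator (fun _ => (1 : ℝ)) (y l)

lemma hitCount_mem_Icc (A : Set E) (y : Fin m → E) : hitCount A y ∈ Set.Icc (0 : ℝ) m := by
  constructor
  · exact Finset.sum_nonneg fun l _ => Set.indicator_nonneg (fun _ _ => zero_le_one) _
  · refine (Finset.sum_le_sum (g := fun _ => (1 : ℝ)) fun l _ => ?_).trans (by simp)
    exact Set.indicator_le_self' (fun _ _ => zero_le_one) _

variable [MeasurableSpace E]

lemma measurable_hitCount {A : Set E} (hA : MeasurableSet A) :
    Measurable (hitCount (m := m) A) :=
  Finset.measurable_sum _ fun l _ => (measurable_const.indicator hA).comp (measurable_pi_apply l)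

variable (ν : Measure E) [IsProbabilityMeasure ν]

lemma mgf_hitCount_le {A : Set E} (hA : MeasurableSet A) {t : ℝ} (ht : |t| ≤ 1) :
    mgf (hitCount (m := m) A) (Measure.pi fun _ => ν) t ≤
      Real.exp (m * ν.real A * (t + t ^ 2)) := by
  have h1 : ∫ x, Real.exp (t * A.indicator (fun _ => (1 : ℝ)) x) ∂ν =
      1 + ν.real A * (Real.exp t - 1) := by
    have : ∀ x, Real.exp (t * A.indicator (fun _ => (1 : ℝ)) x) =
        1 + A.indicator (fun _ => Real.exp t - 1) x := by
      intro x
      by_cases hx : x ∈ A <;> simp [hx]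
    simp_rw [this]
    rw [integral_add (integrable_const _) ((integrable_const _).indicator hA),
      integral_indicator_const _ hA]
    simp
  have h2 : mgf (hitCount (m := m) A) (Measure.pi fun _ => ν) t =
      (1 + ν.real A * (Real.exp t - 1)) ^ m := by
    simp_rw [mgf, hitCount, Finset.mul_sum, Real.exp_sum]
    rw [integral_fintype_prod_eq_pow (fun x => Real.exp (t * A.indicator (fun _ => (1 : ℝ)) x)),
      h1, Fintype.card_fin]
  have h3 : Real.exp t - 1 ≤ t + t ^ 2 := by
    linarith [(abs_le.1 (Real.abs_exp_sub_one_sub_id_le ht)).2]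
  have h4 : 1 + ν.real A * (Real.exp t - 1) ≤ Real.exp (ν.real A * (t + t ^ 2)) :=
    calc 1 + ν.real A * (Real.exp t - 1) ≤ 1 + ν.real A * (t + t ^ 2) := by gcongr
      _ ≤ _ := by linarith [Real.add_one_le_exp (ν.real A * (t + t ^ 2))]
  have h5 : 0 ≤ 1 + ν.real A * (Real.exp t - 1) := h1 ▸ integral_nonneg fun x => (Real.exp_pos _).le
  rw [h2, mul_assoc, Real.exp_nat_mul]
  gcongr

lemma integrable_exp_hitCount {A : Set E} (hA : MeasurableSet A) (t : ℝ) :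
    Integrable (fun y => Real.exp (t * hitCount (m := m) A y)) (Measure.pi fun _ => ν) := by
  refine Integrable.of_bound ((measurable_hitCount hA).const_mul t).exp.aestronglyMeasurable
    (Real.exp (|t| * m)) (Eventually.of_forall fun y => ?_)
  rw [Real.norm_eq_abs, Real.abs_exp, Real.exp_le_exp]
  have := hitCount_mem_Icc A y
  exact mul_le_mul (le_abs_self t) this.2 this.1 (abs_nonneg t)

lemma pi_real_le_hitCount_le {A : Set E} (hA : MeasurableSet A) (a : ℝ) {t : ℝ} (ht₀ : 0 ≤ t)
    (ht₁ : t ≤ 1) :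
    (Measure.pi fun _ => ν).real {y : Fin m → E | a ≤ hitCount A y} ≤
      Real.exp (-t * a + m * ν.real A * (t + t ^ 2)) := by
  refine (measure_ge_le_exp_mul_mgf a ht₀ (integrable_exp_hitCount ν hA t)).trans ?_
  rw [Real.exp_add]
  gcongr
  exact mgf_hitCount_le ν hA (abs_le.2 ⟨by linarith, ht₁⟩)

lemma pi_real_hitCount_le_le {A : Set E} (hA : MeasurableSet A) (a : ℝ) {t : ℝ} (ht₀ : 0 ≤ t)
    (ht₁ : t ≤ 1) :
    (Measure.pi fun _ => ν).real {y : Fin m → E | hitCount A y ≤ a} ≤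
      Real.exp (t * a - m * ν.real A * (t - t ^ 2)) := by
  refine (measure_le_le_exp_mul_mgf a (neg_nonpos.2 ht₀)
    (integrable_exp_hitCount ν hA (-t))).trans ?_
  have h := mgf_hitCount_le (m := m) ν hA (t := -t)
    (by rw [abs_neg]; exact abs_le.2 ⟨by linarith, ht₁⟩)
  calc _ ≤ Real.exp (- -t * a) * Real.exp (m * ν.real A * (-t + (-t) ^ 2)) := by gcongr
    _ = _ := by rw [← Real.exp_add]; congr 1; ring

/-- Leave-one-out: if for every value of one coordinate the remaining ones satisfy a condition with
probability at most `β`, then all coordinates together satisfy it with probability at most `β`. -/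
lemma pi_leaveOneOut_le {W : Set (E × (Fin m → E))} (hW : MeasurableSet W) {β : ENNReal}
    (h : ∀ x, (Measure.pi fun _ => ν) {y : Fin m → E | (x, y) ∈ W} ≤ β) (j : Fin (m + 1)) :
    (Measure.pi fun _ => ν) {S : Fin (m + 1) → E | (S j, j.removeNth S) ∈ W} ≤ β := by
  have hmp := measurePreserving_piFinSuccAbove (fun _ : Fin (m + 1) => ν) j
  have : {S : Fin (m + 1) → E | (S j, j.removeNth S) ∈ W} =
      MeasurableEquiv.piFinSuccAbove (fun _ => E) j ⁻¹' W := rfl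
  rw [this, hmp.measure_preimage hW.nullMeasurableSet, Measure.prod_apply hW]
  calc _ ≤ ∫⁻ _, β ∂ν := lintegral_mono h
    _ = β := by simp

end Chernoff

/-! ### The nearest-neighbour radius -/

section NearestNeighbourRadius

variable {D s : ℕ} {S : Fin s → EuclideanSpace ℝ (Fin D)} {x x₀ : EuclideanSpace ℝ (Fin D)}
  {k ρ ε : ℝ}

lemma card_dist_le_eq_hitCount (S : Fin s → EuclideanSpace ℝ (Fin D))
    (x : EuclideanSpace ℝ (Fin D)) (ρ : ℝ) :
    (Nat.card {j : Fin s // dist (S j) x ≤ ρ} : ℝ) = hitCount (Metric.closedBall x ρ) S := by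
  classical
  simp [hitCount, Set.indicator_apply, Fintype.card_subtype]

lemma knnRadius_le (hk : 0 < k) (h : k ≤ hitCount (Metric.closedBall x ρ) S) :
    knnRadius k S x ≤ ρ := by
  refine csInf_le ⟨0, fun σ hσ => ?_⟩ (by rwa [Set.mem_ofPred_eq, card_dist_le_eq_hitCount])
  have h1 : 0 < (Nat.card {j : Fin s // dist (S j) x ≤ σ} : ℝ) := hk.trans_le hσ
  obtain ⟨⟨j, hj⟩⟩ := (Nat.card_pos_iff.1 (Nat.cast_pos.1 h1)).1
  exact dist_nonneg.trans hj

/-- The inequality is strict because the number of sample points in `closedBall x σ` is constant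
for `σ` slightly larger than `ρ`. -/
lemma lt_knnRadius (hks : k ≤ s) (h : hitCount (Metric.closedBall x ρ) S < k) :
    ρ < knnRadius k S x := by
  obtain ⟨ρ', hρ', hgap⟩ : ∃ ρ' > ρ, ∀ j, dist (S j) x ≤ ρ ∨ ρ' < dist (S j) x := by
    have h1 : ∀ᶠ ρ' in 𝓝[>] ρ, ∀ j, dist (S j) x ≤ ρ ∨ ρ' < dist (S j) x := by
      refine eventually_all.2 fun j => ?_
      by_cases hj : dist (S j) x ≤ ρ
      · exact Eventually.of_forall fun _ => Or.inl hj
      · filter_upwards [mem_nhdsWithin_of_mem_nhds (gt_mem_nhds (not_le.1 hj))] with ρ' h'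
        exact Or.inr h'
    obtain ⟨ρ', h2, h3⟩ := (h1.and self_mem_nhdsWithin).exists
    exact ⟨ρ', h3, h2⟩
  refine hρ'.trans_le (le_csInf ?_ fun σ hσ => ?_)
  · obtain ⟨R, hR⟩ := (Set.finite_range fun j => dist (S j) x).bddAbove
    refine ⟨R, ?_⟩
    have : hitCount (Metric.closedBall x R) S = s := by
      simp [hitCount, fun j => hR ⟨j, rfl⟩]
    rwa [Set.mem_ofPred_eq, card_dist_le_eq_hitCount, this]
  · by_contra! hlt
    rw [Set.mem_ofPred_eq, card_dist_le_eq_hitCount] at hσ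
    refine absurd (hσ.trans (Finset.sum_le_sum fun j _ => ?_)) (not_le.2 h)
    rcases hgap j with hj | hj
    · rw [Set.indicator_of_mem (Metric.mem_closedBall.2 hj)]
      exact Set.indicator_le_self' (fun _ _ => zero_le_one) _
    · rw [Set.indicator_of_notMem (by simpa using hlt.trans hj)]
      exact Set.indicator_nonneg (fun _ _ => zero_le_one) _

lemma IsModeEstimate.dist_le (hx : IsModeEstimate S x)
    (hk : k = (s : ℝ) ^ ((4 : ℝ) / (4 + D))) (hk₀ : 0 < k) (hks : k ≤ s)
    (hnear : ∃ j, dist (S j) x₀ ≤ ρ)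
    (hdense : ∀ j, dist (S j) x₀ ≤ ρ → k ≤ hitCount (Metric.closedBall (S j) ρ) S)
    (hsparse : ∀ j, ε < dist (S j) x₀ → hitCount (Metric.closedBall (S j) ρ) S < k) :
    dist x x₀ ≤ ε := by
  obtain ⟨j, rfl, hmin⟩ := hx
  rw [← hk] at hmin
  obtain ⟨j', hj'⟩ := hnear
  by_contra! hlt
  exact absurd ((hmin j').trans (knnRadius_le hk₀ (hdense j' hj')))
    (not_le.2 (lt_knnRadius hks (hsparse j hlt)))

end NearestNeighbourRadius

/-! ### Balls centred at sample points -/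

section SampleBalls

variable {E : Type*} [PseudoMetricSpace E] {m : ℕ} {ρ : ℝ}

lemma hitCount_closedBall_eq_one_add (hρ : 0 ≤ ρ) (S : Fin (m + 1) → E) (j : Fin (m + 1)) :
    hitCount (Metric.closedBall (S j) ρ) S =
      1 + hitCount (Metric.closedBall (S j) ρ) (j.removeNth S) := by
  rw [hitCount, Fin.sum_univ_succAbove _ j, Set.indicator_of_mem (Metric.mem_closedBall_self hρ)]
  rfl

variable [MeasurableSpace E] [BorelSpace E]
  (ν : Measure E) [IsProbabilityMeasure ν] {q γ : ℝ} {F : Set E}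

lemma pi_forall_notMem_closedBall_le (hq : 0 ≤ q) (hγ₀ : 0 ≤ γ) (hγ₁ : γ ≤ 1 / 2) {x₀ : E}
    (hmass : q * (1 - γ / 2) ≤ (m + 1) * ν.real (Metric.closedBall x₀ ρ)) :
    (Measure.pi fun _ => ν) {S : Fin (m + 1) → E | ∀ j, ρ < dist (S j) x₀} ≤
      ENNReal.ofReal (Real.exp (1 - γ ^ 2 * q / 16)) := by
  rw [← ofReal_measureReal]
  refine ENNReal.ofReal_le_ofReal ?_
  have hsub : {S : Fin (m + 1) → E | ∀ j, ρ < dist (S j) x₀} ⊆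
      {S | hitCount (Metric.closedBall x₀ ρ) S ≤ 0} := by
    intro S hS
    have : hitCount (Metric.closedBall x₀ ρ) S = 0 :=
      Finset.sum_eq_zero fun j _ => Set.indicator_of_notMem (by simpa using hS j) _
    exact this.le
  refine (measureReal_mono hsub).trans ((pi_real_hitCount_le_le ν measurableSet_closedBall _
    (t := 1 / 2) (by norm_num) (by norm_num)).trans (Real.exp_le_exp.2 ?_))
  push_cast
  have : γ ^ 2 * q ≤ q := mul_le_of_le_one_left hq (by nlinarith)
  nlinarith

variable [SecondCountableTopology E]

lemma measurable_hitCount_closedBall (ρ : ℝ) :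
    Measurable fun p : E × (Fin m → E) => hitCount (Metric.closedBall p.1 ρ) p.2 := by
  refine Finset.measurable_sum _ fun l _ => ?_
  have h : MeasurableSet {p : E × (Fin m → E) | dist (p.2 l) p.1 ≤ ρ} :=
    measurableSet_le (by fun_prop) measurable_const
  exact (measurable_const (a := (1 : ℝ))).indicator h

/-- Here `q * (1 - γ)` is the threshold and `q * (1 - 2 * γ)` bounds the expected number of sample
points in the ball. -/
lemma pi_le_hitCount_closedBall_le (hρ : 0 ≤ ρ) (hq : 0 ≤ q) (hγ₀ : 0 ≤ γ) (hγ₁ : γ ≤ 1 / 2)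
    (hF : MeasurableSet F)
    (hmass : ∀ x ∈ F, (m + 1) * ν.real (Metric.closedBall x ρ) ≤ q * (1 - 2 * γ))
    (j : Fin (m + 1)) :
    (Measure.pi fun _ => ν) {S : Fin (m + 1) → E |
      S j ∈ F ∧ q * (1 - γ) ≤ hitCount (Metric.closedBall (S j) ρ) S} ≤
      ENNReal.ofReal (Real.exp (1 - γ ^ 2 * q / 16)) := by
  have hW : MeasurableSet {p : E × (Fin m → E) |
      p.1 ∈ F ∧ q * (1 - γ) ≤ 1 + hitCount (Metric.closedBall p.1 ρ) p.2} :=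
    (measurable_fst hF).inter
      (measurableSet_le measurable_const ((measurable_hitCount_closedBall ρ).const_add 1))
  simp_rw [hitCount_closedBall_eq_one_add hρ]
  refine pi_leaveOneOut_le ν hW (fun x => ?_) j
  by_cases hx : x ∈ F
  swap
  · simp [hx]
  rw [← ofReal_measureReal]
  refine ENNReal.ofReal_le_ofReal ?_
  have hsub : {y : Fin m → E | (x, y) ∈ {p : E × (Fin m → E) |
      p.1 ∈ F ∧ q * (1 - γ) ≤ 1 + hitCount (Metric.closedBall p.1 ρ) p.2}} ⊆
      {y | q * (1 - γ) - 1 ≤ hitCount (Metric.closedBall x ρ) y} := by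
    rintro y ⟨-, hy⟩
    exact sub_le_iff_le_add'.2 hy
  -- `t = γ / 2` minimizes the leading part `t * q * (t - γ)` of the exponent
  refine (measureReal_mono hsub).trans ((pi_real_le_hitCount_le ν measurableSet_closedBall _
    (t := γ / 2) (by linarith) (by linarith)).trans (Real.exp_le_exp.2 ?_))
  have hp : m * ν.real (Metric.closedBall x ρ) ≤ q * (1 - 2 * γ) := by
    linarith [hmass x hx, measureReal_nonneg (μ := ν) (s := Metric.closedBall x ρ)]
  have h1 : m * ν.real (Metric.closedBall x ρ) * (γ / 2 + (γ / 2) ^ 2) ≤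
      q * (1 - 2 * γ) * (γ / 2 + (γ / 2) ^ 2) := by gcongr
  nlinarith [mul_nonneg hq (sq_nonneg γ), mul_nonneg (mul_nonneg hq (sq_nonneg γ)) hγ₀]

/-- Here `q * (1 - γ)` is the threshold and `q * (1 - γ / 2)` bounds the expected number of sample
points in the ball from below. -/
lemma pi_hitCount_closedBall_lt_le (hρ : 0 ≤ ρ) (hq : 0 ≤ q) (hγ₀ : 0 ≤ γ) (hγ₁ : γ ≤ 1 / 2)
    (hF : MeasurableSet F)
    (hmass : ∀ x ∈ F, q * (1 - γ / 2) ≤ (m + 1) * ν.real (Metric.closedBall x ρ))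
    (j : Fin (m + 1)) :
    (Measure.pi fun _ => ν) {S : Fin (m + 1) → E |
      S j ∈ F ∧ hitCount (Metric.closedBall (S j) ρ) S < q * (1 - γ)} ≤
      ENNReal.ofReal (Real.exp (1 - γ ^ 2 * q / 16)) := by
  have hW : MeasurableSet {p : E × (Fin m → E) |
      p.1 ∈ F ∧ 1 + hitCount (Metric.closedBall p.1 ρ) p.2 < q * (1 - γ)} :=
    (measurable_fst hF).inter
      (measurableSet_lt ((measurable_hitCount_closedBall ρ).const_add 1) measurable_const)
  simp_rw [hitCount_closedBall_eq_one_add hρ]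
  refine pi_leaveOneOut_le ν hW (fun x => ?_) j
  by_cases hx : x ∈ F
  swap
  · simp [hx]
  rw [← ofReal_measureReal]
  refine ENNReal.ofReal_le_ofReal ?_
  have hsub : {y : Fin m → E | (x, y) ∈ {p : E × (Fin m → E) |
      p.1 ∈ F ∧ 1 + hitCount (Metric.closedBall p.1 ρ) p.2 < q * (1 - γ)}} ⊆
      {y | hitCount (Metric.closedBall x ρ) y ≤ q * (1 - γ) - 1} := by
    rintro y ⟨-, hy⟩
    exact le_sub_iff_add_le'.2 (le_of_lt hy)
  -- `t = γ / 4` minimizes the leading part `t * q * (t - γ / 2)` of the exponent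
  refine (measureReal_mono hsub).trans ((pi_real_hitCount_le_le ν measurableSet_closedBall _
    (t := γ / 4) (by linarith) (by linarith)).trans (Real.exp_le_exp.2 ?_))
  have hp : q * (1 - γ / 2) - 1 ≤ m * ν.real (Metric.closedBall x ρ) := by
    linarith [hmass x hx, measureReal_le_one (μ := ν) (s := Metric.closedBall x ρ)]
  have h0 : 0 ≤ γ / 4 - (γ / 4) ^ 2 := by nlinarith
  have h1 : (q * (1 - γ / 2) - 1) * (γ / 4 - (γ / 4) ^ 2) ≤
      m * ν.real (Metric.closedBall x ρ) * (γ / 4 - (γ / 4) ^ 2) := by gcongr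
  nlinarith [mul_nonneg hq (sq_nonneg γ), mul_nonneg (mul_nonneg hq (sq_nonneg γ)) hγ₀]

end SampleBalls

/-! ### Concentration of the mode estimator -/

section ModeEstimator

variable {D : ℕ} {f : EuclideanSpace ℝ (Fin D) → ℝ}

/-- The mode estimator errs by more than `ε` only if a sample point far from the mode has too many
neighbours, a sample point near the mode has too few, or no sample point is near the mode. -/
lemma pi_modeEstimate_le_of_ball_mass (ν : Measure (EuclideanSpace ℝ (Fin D)))
    [IsProbabilityMeasure ν] {x₀ : EuclideanSpace ℝ (Fin D)} {s : ℕ} (hs : 1 ≤ s)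
    {ρ ε q γ : ℝ} (hρ : 0 ≤ ρ) (hq : 0 ≤ q) (hγ₀ : 0 ≤ γ) (hγ₁ : γ ≤ 1 / 2)
    (hk : q * (1 - γ) = (s : ℝ) ^ ((4 : ℝ) / (4 + D)))
    (hnear : ∀ x, dist x x₀ ≤ ρ → q * (1 - γ / 2) ≤ s * ν.real (Metric.closedBall x ρ))
    (hfar : ∀ x, ε < dist x x₀ → s * ν.real (Metric.closedBall x ρ) ≤ q * (1 - 2 * γ)) :
    (Measure.pi fun _ => ν) {S : Fin s → EuclideanSpace ℝ (Fin D) |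
      ∃ x, IsModeEstimate S x ∧ ε < dist x x₀} ≤
      ENNReal.ofReal ((2 * s + 1) * Real.exp (1 - γ ^ 2 * q / 16)) := by
  obtain ⟨m, rfl⟩ : ∃ m, s = m + 1 := ⟨s - 1, by omega⟩
  push_cast at hnear hfar
  set β := ENNReal.ofReal (Real.exp (1 - γ ^ 2 * q / 16)) with hβ
  have hm : (1 : ℝ) ≤ ((m + 1 : ℕ) : ℝ) := by exact_mod_cast hs
  have hk₀ : 0 < q * (1 - γ) := hk ▸ Real.rpow_pos_of_pos (by linarith) _
  have hks : q * (1 - γ) ≤ ((m + 1 : ℕ) : ℝ) := by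
    rw [hk]
    refine (Real.rpow_le_rpow_of_exponent_le hm (y := (4 : ℝ) / (4 + D)) (z := 1) ?_).trans
      (Real.rpow_one _).le
    rw [div_le_one (by positivity)]
    simp
  let A : Fin (m + 1) → Set (Fin (m + 1) → EuclideanSpace ℝ (Fin D)) := fun j =>
    {S | S j ∈ {x | ε < dist x x₀} ∧ q * (1 - γ) ≤ hitCount (Metric.closedBall (S j) ρ) S}
  let B : Fin (m + 1) → Set (Fin (m + 1) → EuclideanSpace ℝ (Fin D)) := fun j =>
    {S | S j ∈ Metric.closedBall x₀ ρ ∧ hitCount (Metric.closedBall (S j) ρ) S < q * (1 - γ)}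
  let C : Set (Fin (m + 1) → EuclideanSpace ℝ (Fin D)) := {S | ∀ j, ρ < dist (S j) x₀}
  have hsub : {S : Fin (m + 1) → EuclideanSpace ℝ (Fin D) |
      ∃ x, IsModeEstimate S x ∧ ε < dist x x₀} ⊆ (⋃ j, A j) ∪ (⋃ j, B j) ∪ C := by
    rintro S ⟨x, hx, hlt⟩
    by_contra hS
    simp only [Set.mem_union, Set.mem_iUnion, not_or, not_exists] at hS
    obtain ⟨⟨hA, hB⟩, hC⟩ := hS
    refine absurd (hx.dist_le hk hk₀ hks (x₀ := x₀) (ρ := ρ) (ε := ε) ?_ ?_ ?_) (not_le.2 hlt)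
    · by_contra! h
      exact hC h
    · intro j hj
      by_contra! h
      exact hB j ⟨hj, h⟩
    · intro j hj
      by_contra! h
      exact hA j ⟨hj, h⟩
  have hA : ∀ j, (Measure.pi fun _ => ν) (A j) ≤ β :=
    pi_le_hitCount_closedBall_le ν hρ hq hγ₀ hγ₁
      (measurableSet_lt measurable_const (by fun_prop)) hfar
  have hB : ∀ j, (Measure.pi fun _ => ν) (B j) ≤ β :=
    pi_hitCount_closedBall_lt_le ν hρ hq hγ₀ hγ₁ measurableSet_closedBall hnear
  have hC : (Measure.pi fun _ => ν) C ≤ β :=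
    pi_forall_notMem_closedBall_le ν hq hγ₀ hγ₁ (hnear x₀ (by simpa using hρ))
  calc _ ≤ ∑ j, (Measure.pi fun _ => ν) (A j) + ∑ j, (Measure.pi fun _ => ν) (B j) +
        (Measure.pi fun _ => ν) C :=
      (measure_mono hsub).trans ((measure_union_le _ _).trans (add_le_add
        ((measure_union_le _ _).trans (add_le_add (measure_iUnion_fintype_le _ _)
          (measure_iUnion_fintype_le _ _))) le_rfl))
    _ ≤ ∑ j : Fin (m + 1), β + ∑ j : Fin (m + 1), β + β := by
      gcongr with j _ j _
      · exact hA j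
      · exact hB j
    _ = _ := by
      rw [ENNReal.ofReal_mul (by positivity), ← hβ, Finset.sum_const, Finset.card_univ,
        Fintype.card_fin, nsmul_eq_mul, ENNReal.ofReal_add (by positivity) zero_le_one,
        ENNReal.ofReal_mul zero_le_two, ENNReal.ofReal_natCast]
      simp
      ring

/-- The error of the mode estimator exceeds `ε = ℓ * s ^ (-1 / (4 + D))` with small probability. A
ball near the mode holds about `k = s ^ (4 / (4 + D))` sample points when its radius is of order
`s ^ (-1 / (4 + D))`, which is small compared to `ε`. At distance `ε` from the mode its mass is
smaller by a relative amount of order `γ = ε ^ 2`, and the probability that the counts deviate by as much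
is of order `exp (-c * γ ^ 2 * k) = exp (-c * ℓ ^ 4)`. -/
lemma IsUnimodalDensity.exists_pi_modeEstimate_le (hD : 1 ≤ D) (hf : IsUnimodalDensity f) :
    ∃ ℓ₀ : ℝ, ∃ ε₀ > 0, ∀ ℓ, ℓ₀ ≤ ℓ → ∀ s : ℕ, 1 ≤ s →
      ℓ / (s : ℝ) ^ ((1 : ℝ) / (4 + D)) ≤ ε₀ →
      (Measure.pi fun _ => lawOf f) {S : Fin s → EuclideanSpace ℝ (Fin D) |
        ∃ x, IsModeEstimate S x ∧ ℓ / (s : ℝ) ^ ((1 : ℝ) / (4 + D)) < dist x (modeOf f)} ≤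
      ENNReal.ofReal (3 * s * Real.exp (-(5 * ℓ))) := by
  have := hf.isProbabilityMeasure_lawOf
  obtain ⟨C, hC, rC, hrC, hlow⟩ := hf.exists_lower_bound
  obtain ⟨c, hc, rc, hrc, hup⟩ := hf.exists_upper_bound
  set x₀ := modeOf f
  have hf₀ : 0 < f x₀ := hf.mode_pos
  have hv : 0 < unitBallVolume D := unitBallVolume_pos D
  set v := unitBallVolume D
  -- the radius `ρ` below is at most `B / w`, where `w = s ^ (1 / (4 + D))`
  set B : ℝ := (2 / (f x₀ * v)) ^ ((1 : ℝ) / D) with hB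
  have hB₀ : 0 < B := by positivity
  set g : ℝ := c / (8 * f x₀) with hg
  have hg₀ : 0 < g := by positivity
  -- `ρ ≤ κ * ε` makes the loss of mass near the mode at most a quarter of that at distance `ε`
  obtain ⟨κ, hκ₀, hκ₁, hκ₂⟩ : ∃ κ > 0, κ ≤ 1 / 2 ∧ 64 * C * κ ^ 2 ≤ c := by
    refine ⟨min (1 / 2) (Real.sqrt (c / (64 * C))), by positivity, min_le_left _ _, ?_⟩
    calc 64 * C * min (1 / 2) (Real.sqrt (c / (64 * C))) ^ 2
        ≤ 64 * C * Real.sqrt (c / (64 * C)) ^ 2 := by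
          gcongr
          exact min_le_right _ _
      _ = c := by rw [Real.sq_sqrt (by positivity)]; field_simp
  obtain ⟨e, he₀, hegap⟩ : ∃ e > 0, g * e ^ 2 ≤ 1 / 2 := by
    refine ⟨Real.sqrt (1 / (2 * g)), by positivity, ?_⟩
    rw [Real.sq_sqrt (by positivity)]
    apply le_of_eq
    field_simp
  refine ⟨max (max 1 (B / κ)) (96 / g ^ 2), min (min rc (rC / 2)) e, by positivity,
    fun ℓ hℓ s hs hε => ?_⟩
  have hℓ1 : 1 ≤ ℓ := (le_max_left _ _).trans ((le_max_left _ _).trans hℓ)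
  have hℓB : B / κ ≤ ℓ := (le_max_right _ _).trans ((le_max_left _ _).trans hℓ)
  have hℓg : 96 / g ^ 2 ≤ ℓ := (le_max_right _ _).trans hℓ
  have hℓ₀ : 0 < ℓ := by linarith
  have hs₀ : (0 : ℝ) < s := by exact_mod_cast hs
  set w : ℝ := (s : ℝ) ^ ((1 : ℝ) / (4 + D)) with hw
  have hw₀ : 0 < w := by positivity
  have hD4 : (4 + D : ℝ) ≠ 0 := by positivity
  have hwpow : w ^ (4 + D) = s := by
    rw [hw, ← Real.rpow_natCast, ← Real.rpow_mul hs₀.le]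
    push_cast
    rw [one_div_mul_cancel hD4, Real.rpow_one]
  have hw4 : (s : ℝ) ^ ((4 : ℝ) / (4 + D)) = w ^ 4 := by
    rw [hw, ← Real.rpow_natCast, ← Real.rpow_mul hs₀.le]
    congr 1
    push_cast
    ring
  set ε := ℓ / w with hεdef
  have hε₀ : 0 < ε := by positivity
  have hεrc : ε ≤ rc := hε.trans ((min_le_left _ _).trans (min_le_left _ _))
  have hεrC : ε ≤ rC / 2 := hε.trans ((min_le_left _ _).trans (min_le_right _ _))
  have hεe : ε ≤ e := hε.trans (min_le_right _ _)
  set γ := g * ε ^ 2 with hγ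
  have hγ₀ : 0 < γ := by positivity
  have hγ₁ : γ ≤ 1 / 2 :=
    (mul_le_mul_of_nonneg_left (pow_le_pow_left₀ hε₀.le hεe 2) hg₀.le).trans hegap
  have hfγ : f x₀ * γ = c * ε ^ 2 / 8 := by
    rw [hγ, hg]
    field_simp
  have hγ' : 0 < 1 - γ := by linarith
  -- `ρ` solves `s * f x₀ * v * ρ ^ D * (1 - γ) = k`
  set ρ : ℝ := (1 / (f x₀ * v * (1 - γ))) ^ ((1 : ℝ) / D) / w with hρ
  have hρ₀ : 0 < ρ := by positivity
  have hρD : ρ ^ D * w ^ D = 1 / (f x₀ * v * (1 - γ)) := by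
    rw [← mul_pow, hρ, div_mul_cancel₀ _ hw₀.ne', ← Real.rpow_natCast,
      ← Real.rpow_mul (by positivity), one_div_mul_cancel (by positivity), Real.rpow_one]
  have hρκ : ρ ≤ κ * ε := by
    have h1 : (1 / (f x₀ * v * (1 - γ))) ^ ((1 : ℝ) / D) ≤ B := by
      refine Real.rpow_le_rpow (by positivity) ?_ (by positivity)
      rw [div_le_div_iff₀ (by positivity) (by positivity)]
      nlinarith [mul_pos hf₀ hv]
    have h2 : B ≤ κ * ℓ := by
      rw [div_le_iff₀ hκ₀] at hℓB
      linarith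
    rw [hρ, hεdef, ← mul_div_assoc]
    gcongr
    exact h1.trans h2
  have hρε : ρ ≤ ε / 2 := hρκ.trans ((mul_le_mul_of_nonneg_right hκ₁ hε₀.le).trans (by linarith))
  set q : ℝ := s * (f x₀ * (ρ ^ D * v)) with hq
  have hq₀ : 0 < q := by positivity
  have hqk : q * (1 - γ) = w ^ 4 := by
    have : q * (1 - γ) = w ^ 4 * (ρ ^ D * w ^ D * (f x₀ * v * (1 - γ))) := by
      rw [hq, ← hwpow, pow_add]
      ring
    rw [this, hρD, one_div_mul_cancel (by positivity), mul_one]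
  refine (pi_modeEstimate_le_of_ball_mass (lawOf f) hs hρ₀.le hq₀.le hγ₀.le hγ₁ (hqk.trans hw4.symm)
    ?_ ?_).trans (ENNReal.ofReal_le_ofReal ?_)
  · intro x hx
    have := le_lawOf_real_closedBall hf hρ₀.le (M := f x₀ * (1 - γ / 2)) (x := x)
      (mul_nonneg hf₀.le (by linarith)) fun y hy => ?_
    · calc q * (1 - γ / 2) = s * (f x₀ * (1 - γ / 2) * (ρ ^ D * v)) := by rw [hq]; ring
        _ ≤ _ := by gcongr
    have hyd : dist y x₀ ≤ 2 * (κ * ε) := by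
      have := dist_triangle y x x₀
      have := Metric.mem_closedBall.1 hy
      linarith
    have hκε : κ * ε ≤ 1 / 2 * ε := by gcongr
    have h1 := hlow y (by linarith)
    have h2 : C * dist y x₀ ^ 2 ≤ C * (2 * (κ * ε)) ^ 2 := by gcongr
    have h3 : 64 * C * κ ^ 2 * ε ^ 2 ≤ c * ε ^ 2 := by gcongr
    linarith
  · intro x hx
    have := lawOf_real_closedBall_le (f := f) hρ₀.le (M := f x₀ * (1 - 2 * γ)) (x := x)
      (mul_nonneg hf₀.le (by linarith)) fun y hy => ?_
    · calc _ ≤ s * (f x₀ * (1 - 2 * γ) * (ρ ^ D * v)) := by gcongr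
        _ = _ := by rw [hq]; ring
    have hyd : ε / 2 ≤ dist y x₀ := by
      have := dist_triangle_left x x₀ y
      have := Metric.mem_closedBall.1 hy
      linarith
    have h1 := hup (ε / 2) (by positivity) (by linarith) y hyd
    linarith
  · have h1 : g ^ 2 * ℓ ^ 4 ≤ γ ^ 2 * q := by
      have h2 : w ^ 4 ≤ q := by
        rw [← hqk]
        exact mul_le_of_le_one_right hq₀.le (by linarith)
      calc g ^ 2 * ℓ ^ 4 = γ ^ 2 * w ^ 4 := by
            rw [hγ, hεdef]
            field_simp
        _ ≤ _ := by gcongr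
    have h2 : 96 * ℓ ≤ g ^ 2 * ℓ ^ 4 := by
      rw [div_le_iff₀ (by positivity)] at hℓg
      have h4 : ℓ ^ 2 ≤ ℓ ^ 4 := pow_le_pow_right₀ hℓ1 (by norm_num)
      calc 96 * ℓ ≤ ℓ * g ^ 2 * ℓ := by gcongr
        _ = g ^ 2 * ℓ ^ 2 := by ring
        _ ≤ _ := by gcongr
    have h3 : (1 : ℝ) ≤ s := by exact_mod_cast hs
    gcongr <;> linarith

end ModeEstimator

/-! ### Validity of the confidence bands -/

section ConfidenceBand

variable {D : ℕ}

/-- The confidence band of width `ℓ * log s / s ^ (1 / (4 + D))` needs no constant depending on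
`f` or `L`: where the band is narrower than `1`, the sample size `s` is at least a multiple of `ℓ`,
so that the factor `log s` exceeds any such constant once `ℓ` is large. -/
lemma IsUnimodalDensity.exists_pi_score_band_le (hD : 1 ≤ D)
    {f : EuclideanSpace ℝ (Fin D) → ℝ} (hf : IsUnimodalDensity f) (L : NNReal) :
    ∃ ℓ₀ : ℝ, ∀ r : EuclideanSpace ℝ (Fin D) → ℝ, (∀ x, r x ∈ Set.Icc (0 : ℝ) 1) →
      LipschitzWith L r → ∀ ℓ, ℓ₀ ≤ ℓ → ∀ s : ℕ, 2 ≤ s →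
      (Measure.pi fun _ => lawOf f) {S : Fin s → EuclideanSpace ℝ (Fin D) |
        ∃ x, IsModeEstimate S x ∧
          ℓ * Real.log s / (s : ℝ) ^ ((1 : ℝ) / (4 + D)) < |r x - r (modeOf f)|} ≤
      ENNReal.ofReal (3 * s * Real.exp (-(5 * ℓ))) := by
  obtain ⟨ℓ₁, ε₀, hε₀, hconc⟩ := hf.exists_pi_modeEstimate_le hD
  have hlog2 : 0 < Real.log 2 := Real.log_pos one_lt_two
  set Λ : ℝ := max (1 / ε₀) L with hΛ
  refine ⟨max (max 1 ℓ₁) (Real.exp Λ / Real.log 2), fun r hr hL ℓ hℓ s hs => ?_⟩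
  have hℓ1 : 1 ≤ ℓ := (le_max_left _ _).trans ((le_max_left _ _).trans hℓ)
  have hℓℓ : ℓ₁ ≤ ℓ := (le_max_right _ _).trans ((le_max_left _ _).trans hℓ)
  have hℓΛ : Real.exp Λ / Real.log 2 ≤ ℓ := (le_max_right _ _).trans hℓ
  have hs2 : (2 : ℝ) ≤ s := by exact_mod_cast hs
  have hlogs : Real.log 2 ≤ Real.log s := Real.log_le_log two_pos hs2
  set w : ℝ := (s : ℝ) ^ ((1 : ℝ) / (4 + D)) with hw
  have hw₀ : 0 < w := by positivity
  have hws : w ≤ s := by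
    refine (Real.rpow_le_rpow_of_exponent_le (by linarith) (z := 1) ?_).trans (Real.rpow_one _).le
    rw [div_le_one (by positivity)]
    linarith [(Nat.cast_nonneg D : (0 : ℝ) ≤ D)]
  rcases le_or_gt w (ℓ * Real.log s) with hwide | hnarrow
  · -- the band has width at least `1`, the diameter of the range of `r`
    refine le_of_eq_of_le ?_ zero_le
    refine measure_mono_null (t := ∅) ?_ measure_empty
    rintro S ⟨x, -, hx⟩
    have h1 : |r x - r (modeOf f)| ≤ 1 :=
      abs_sub_le_of_le_of_le (hr x).1 (hr x).2 (hr _).1 (hr _).2 |>.trans (by norm_num)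
    exact absurd (h1.trans ((one_le_div hw₀).2 hwide)) (not_le.2 hx)
  · have hlogΛ : Λ ≤ Real.log s := by
      rw [Real.le_log_iff_exp_le (by linarith)]
      rw [div_le_iff₀ hlog2] at hℓΛ
      calc Real.exp Λ ≤ ℓ * Real.log 2 := hℓΛ
        _ ≤ ℓ * Real.log s := by gcongr
        _ ≤ s := hnarrow.le.trans hws
    have hlog₀ : 0 < Real.log s := hlog2.trans_le hlogs
    have hsmall : ℓ / w ≤ ε₀ := by
      have h1 : 1 / ε₀ ≤ Real.log s := (le_max_left _ _).trans hlogΛ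
      rw [div_le_iff₀ hε₀] at h1
      rw [div_le_iff₀ hw₀]
      nlinarith
    refine (measure_mono ?_).trans (hconc ℓ hℓℓ s (by omega) hsmall)
    rintro S ⟨x, hx, hlt⟩
    refine ⟨x, hx, ?_⟩
    by_contra! hle
    have h1 : |r x - r (modeOf f)| ≤ L * dist x (modeOf f) := hL.dist_le_mul x (modeOf f)
    have h2 : L * dist x (modeOf f) ≤ Real.log s * (ℓ / w) := by
      gcongr
      exact (le_max_right _ _).trans hlogΛ
    rw [mul_comm ℓ, mul_div_assoc] at hlt
    linarith

/-- The probability that some score estimate leaves its confidence band, for confidence parameter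
`δ / n`, by a union bound over at most `n` arms and `n` sample sizes. -/
lemma measure_exists_band_lt_le {K n : ℕ} {f : Fin K → EuclideanSpace ℝ (Fin D) → ℝ}
    {r : EuclideanSpace ℝ (Fin D) → ℝ} {Ω : Type*} [MeasurableSpace Ω] {μ : Measure Ω}
    [IsProbabilityMeasure μ] {X : Fin K → ℕ → Ω → EuclideanSpace ℝ (Fin D)}
    (hX : ∀ i j, Measurable (X i j)) (hlaw : ∀ i j, μ.map (X i j) = lawOf (f i))
    (hind : iIndepFun (fun p : Fin K × ℕ => X p.1 p.2) μ) {δ : ℝ} (hδ₀ : 0 < δ) (hδ₁ : δ < 1)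
    (hn : 2 ≤ n) (hKn : K ≤ n)
    (hband : ∀ i, ∀ s : ℕ, 2 ≤ s → (Measure.pi fun _ => lawOf (f i))
      {S : Fin s → EuclideanSpace ℝ (Fin D) | ∃ x, IsModeEstimate S x ∧
        Real.log (1 / (δ / n)) * Real.log s / (s : ℝ) ^ ((1 : ℝ) / (4 + D)) <
          |r x - r (modeOf (f i))|} ≤
      ENNReal.ofReal (3 * s * Real.exp (-(5 * Real.log (1 / (δ / n)))))) :
    μ {ω | ∃ i, ∃ s ∈ Finset.Icc 2 n, ∃ x, IsModeEstimate (fun j : Fin s => X i j ω) x ∧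
        Real.log (1 / (δ / n)) * Real.log s / (s : ℝ) ^ ((1 : ℝ) / (4 + D)) <
          |r x - r (modeOf (f i))|} ≤ ENNReal.ofReal δ := by
  have hn₀ : (2 : ℝ) ≤ n := by exact_mod_cast hn
  set ℓ := Real.log (1 / (δ / n)) with hℓ
  have hexp : Real.exp (-(5 * ℓ)) = (δ / n) ^ 5 := by
    rw [hℓ, one_div, Real.log_inv, mul_neg, neg_neg,
      show (5 : ℝ) = ((5 : ℕ) : ℝ) by norm_num, Real.exp_nat_mul, Real.exp_log (by positivity)]
  set V : Fin K → (s : ℕ) → Set (Fin s → EuclideanSpace ℝ (Fin D)) := fun i s =>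
    {S | ∃ x, IsModeEstimate S x ∧
      ℓ * Real.log s / (s : ℝ) ^ ((1 : ℝ) / (4 + D)) < |r x - r (modeOf (f i))|}
  have hsingle : ∀ i, ∀ s ∈ Finset.Icc 2 n, μ ((fun ω (j : Fin s) => X i j ω) ⁻¹' V i s) ≤
      ENNReal.ofReal (3 * n * (δ / n) ^ 5) := by
    intro i s hs
    rw [Finset.mem_Icc] at hs
    have hinj : Function.Injective fun j : Fin s => (i, (j : ℕ)) := fun j j' h =>
      Fin.ext (Prod.ext_iff.1 h).2
    have hmap : μ.map (fun ω (j : Fin s) => X i j ω) = Measure.pi fun _ => lawOf (f i) := by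
      rw [(iIndepFun_iff_map_fun_eq_pi_map fun j : Fin s => (hX i j).aemeasurable).1
        (hind.precomp hinj)]
      simp_rw [hlaw]
    have hsn : (s : ℝ) ≤ n := by exact_mod_cast hs.2
    refine (Measure.le_map_apply (measurable_pi_lambda _ fun j : Fin s => hX i j).aemeasurable
      _).trans ?_
    rw [hmap]
    refine (hband i s hs.1).trans (ENNReal.ofReal_le_ofReal ?_)
    rw [hexp]
    gcongr
  calc _ ≤ μ (⋃ i, ⋃ s ∈ Finset.Icc 2 n, (fun ω (j : Fin s) => X i j ω) ⁻¹' V i s) := by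
        refine measure_mono ?_
        rintro ω ⟨i, s, hs, h⟩
        exact Set.mem_iUnion.2 ⟨i, Set.mem_iUnion₂.2 ⟨s, hs, h⟩⟩
    _ ≤ ∑ i : Fin K, ∑ s ∈ Finset.Icc 2 n, ENNReal.ofReal (3 * n * (δ / n) ^ 5) := by
        refine (measure_iUnion_fintype_le _ _).trans (Finset.sum_le_sum fun i _ => ?_)
        exact (measure_biUnion_finset_le _ _).trans (Finset.sum_le_sum (hsingle i))
    _ = ENNReal.ofReal (K * ((n - 1 : ℕ) * (3 * n * (δ / n) ^ 5))) := by
        generalize 3 * n * (δ / n) ^ 5 = b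
        rw [Finset.sum_const, Finset.sum_const, Finset.card_univ, Fintype.card_fin, Nat.card_Icc,
          nsmul_eq_mul, nsmul_eq_mul, ENNReal.ofReal_mul (by positivity),
          ENNReal.ofReal_mul (by positivity), ENNReal.ofReal_natCast, ENNReal.ofReal_natCast]
        rfl
    _ ≤ ENNReal.ofReal δ := by
        refine ENNReal.ofReal_le_ofReal ?_
        have h1 : (K : ℝ) ≤ n := by exact_mod_cast hKn
        have h2 : ((n - 1 : ℕ) : ℝ) ≤ n := by exact_mod_cast Nat.sub_le n 1
        calc (K : ℝ) * ((n - 1 : ℕ) * (3 * n * (δ / n) ^ 5))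
            ≤ n * (n * (3 * n * (δ / n) ^ 5)) := by gcongr
          _ = 3 / n ^ 2 * (δ ^ 4 * δ) := by field_simp
          _ ≤ 1 * (1 * δ) := by
            gcongr
            · rw [div_le_one (by positivity)]
              nlinarith
            · exact pow_le_one₀ hδ₀.le hδ₁.le
          _ = δ := by ring

end ConfidenceBand

/-! ### Pulls of suboptimal arms -/

section PullCounts

variable {D K n : ℕ}

lemma pulls_succ (I : ℕ → Fin K) (i : Fin K) (t : ℕ) :
    pulls I i (t + 1) = pulls I i t + if I (t + 1) = i then 1 else 0 := by
  have h : Finset.Icc 1 (t + 1) = insert (t + 1) (Finset.Icc 1 t) :=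
    (Finset.insert_Icc_right_eq_Icc_succ (a := 1) (b := t) (by simp)).symm
  rw [pulls, h, Finset.filter_insert]
  split_ifs
  · rw [Finset.card_insert_of_notMem (by simp)]
    rfl
  · rfl

lemma pulls_le (I : ℕ → Fin K) (i : Fin K) (t : ℕ) : pulls I i t ≤ t :=
  (Finset.card_filter_le _ _).trans (by simp)

lemma sum_pulls (I : ℕ → Fin K) (t : ℕ) : ∑ i, pulls I i t = t := by
  have := Finset.card_eq_sum_card_fiberwise (s := Finset.Icc 1 t) (t := Finset.univ) (f := I)
    (fun _ _ => Finset.mem_coe.2 (Finset.mem_univ _))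
  simpa [pulls] using this.symm

lemma ucbIndex_of_two_le {δ : ℝ} {T : ℕ} (hT : 2 ≤ T) (v : ℝ) : ucbIndex D δ T v =
    ((v + Real.log (1 / δ) * Real.log T / (T : ℝ) ^ ((1 : ℝ) / (4 + D)) : ℝ) : EReal) :=
  if_neg (by omega)

variable {r : EuclideanSpace ℝ (Fin D) → ℝ} {δ : ℝ} {X : Fin K → ℕ → EuclideanSpace ℝ (Fin D)}
  {I : ℕ → Fin K} {θ : Fin K → ℝ} {a i : Fin K}

/-- As long as all estimates lie in their confidence bands, a suboptimal arm `i` is pulled beyond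
its second time only while twice its band is at least the gap `θ a - θ i`. -/
lemma IsUCBRun.pulls_le (hrun : IsUCBRun r n δ X I) (hℓ : 0 ≤ Real.log (1 / δ))
    (hband : ∀ i, ∀ s ∈ Finset.Icc 2 n, ∀ x, IsModeEstimate (fun j : Fin s => X i j) x →
      |r x - θ i| ≤ Real.log (1 / δ) * Real.log s / (s : ℝ) ^ ((1 : ℝ) / (4 + D)))
    (hgap : θ i < θ a) :
    (pulls I i n : ℝ) ≤
      (2 * Real.log (1 / δ) * Real.log n) ^ (4 + D) * ((θ a - θ i) ^ (4 + D))⁻¹ + 2 := by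
  obtain ⟨est, hest, hmax⟩ := hrun
  set ℓ := Real.log (1 / δ)
  set Δ := θ a - θ i
  have hΔ : 0 < Δ := sub_pos.2 hgap
  have hlogn : 0 ≤ Real.log n := Real.log_natCast_nonneg n
  set B := (2 * ℓ * Real.log n) ^ (4 + D) * (Δ ^ (4 + D))⁻¹ with hB
  have hB₀ : 0 ≤ B := by positivity
  have hbandt : ∀ i t, t < n → 2 ≤ pulls I i t → |r (est i t) - θ i| ≤
      ℓ * Real.log (pulls I i t) / (pulls I i t : ℝ) ^ ((1 : ℝ) / (4 + D)) := fun i t ht h2 =>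
    hband i _ (Finset.mem_Icc.2 ⟨h2, (ModalBandit.pulls_le I i t).trans ht.le⟩) _
      (hest i t (by omega))
  have key : ∀ t, t < n → I (t + 1) = i → 2 ≤ pulls I i t → (pulls I i t : ℝ) ≤ B := by
    intro t ht hI h2
    have hle := hmax t ht a
    rw [hI, ucbIndex_of_two_le h2] at hle
    have h2a : 2 ≤ pulls I a t := by
      by_contra! hlt
      rw [ucbIndex, if_pos (by omega), top_le_iff] at hle
      exact EReal.coe_ne_top _ hle
    rw [ucbIndex_of_two_le h2a, EReal.coe_le_coe_iff] at hle
    have ha := (abs_le.1 (hbandt a t ht h2a)).1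
    have hi := (abs_le.1 (hbandt i t ht h2)).2
    set T := pulls I i t
    have hT₀ : (0 : ℝ) < T := by exact_mod_cast (by omega : 0 < T)
    have hTn : (T : ℝ) ≤ n := by exact_mod_cast (ModalBandit.pulls_le I i t).trans ht.le
    set w : ℝ := (T : ℝ) ^ ((1 : ℝ) / (4 + D)) with hw
    have hw₀ : 0 < w := by positivity
    have h4 : Δ ≤ 2 * (ℓ * Real.log T / w) := by linarith
    have h5 : Δ ≤ 2 * ℓ * Real.log n / w := by
      refine h4.trans ?_
      rw [← mul_div_assoc, ← mul_assoc]
      gcongr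
    have h6 : w ≤ 2 * ℓ * Real.log n / Δ := by
      rw [le_div_iff₀ hw₀] at h5
      rw [le_div_iff₀ hΔ]
      linarith
    have hwT : w ^ (4 + D) = T := by
      rw [hw, ← Real.rpow_natCast, ← Real.rpow_mul hT₀.le]
      push_cast
      rw [one_div_mul_cancel (by positivity), Real.rpow_one]
    calc (T : ℝ) = w ^ (4 + D) := hwT.symm
      _ ≤ (2 * ℓ * Real.log n / Δ) ^ (4 + D) := by gcongr
      _ = B := by rw [div_pow, hB, div_eq_mul_inv]
  have hind : ∀ t, t ≤ n → (pulls I i t : ℝ) ≤ B + 2 := by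
    intro t
    induction t with
    | zero =>
      intro _
      have : pulls I i 0 = 0 := Nat.le_zero.1 (ModalBandit.pulls_le I i 0)
      rw [this, Nat.cast_zero]
      linarith
    | succ t ih =>
      intro ht
      rw [pulls_succ]
      split_ifs with hI
      · rcases le_or_gt 2 (pulls I i t) with h2 | h2
        · push_cast
          linarith [key t ht hI h2]
        · have : ((pulls I i t + 1 : ℕ) : ℝ) ≤ 2 := by exact_mod_cast h2
          linarith
      · exact ih (by omega)
  exact hind n le_rfl

end PullCounts

/-! ### The horizon -/

section GapSum

variable {D K : ℕ} {θ : Fin K → ℝ} {a : Fin K}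

lemma le_gapSum_add_one (hθ : ∀ i, θ i ∈ Set.Icc (0 : ℝ) 1) (hlt : ∀ i, i ≠ a → θ i < θ a) :
    (K : ℝ) ≤ gapSum D θ a + 1 := by
  have h : ∑ i ∈ Finset.univ.erase a, (1 : ℝ) ≤ gapSum D θ a := by
    refine Finset.sum_le_sum fun i hi => ?_
    have hΔ : 0 < θ a - θ i := sub_pos.2 (hlt i (Finset.ne_of_mem_erase hi))
    refine (one_le_inv₀ (by positivity)).2 (pow_le_one₀ hΔ.le ?_)
    linarith [(hθ a).2, (hθ i).1]
  have hK : 1 ≤ K := a.pos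
  rw [Finset.sum_const, Finset.card_erase_of_mem (Finset.mem_univ _), Finset.card_univ,
    Fintype.card_fin, nsmul_eq_mul, mul_one, Nat.cast_sub hK, Nat.cast_one] at h
  linarith

/-- The horizon `x` that keeps the number of suboptimal pulls below `x / 2`, where `G` is the sum of
the inverse powers of the gaps, `E` their exponent and `b = log (1 / δ)`. With `y = x / G` and
`s = b + log G`, the number of pulls is at most `(2 ^ E * (log y + s) ^ (2 * E) + 2) * G`, and
powers of `log y` are `o(y)`. -/
lemma exists_polynomial_horizon (E : ℕ) : ∃ A : ℝ, 2 ≤ A ∧ ∀ G b x : ℝ, 1 ≤ G → 0 ≤ b →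
    A * (1 + b + Real.log G) ^ (2 * E) * G ≤ x →
    ((2 * (Real.log x + b) * Real.log x) ^ E + 2) * G < x / 2 := by
  have hη : (0 : ℝ) < 1 / (8 * 8 ^ E) := by positivity
  obtain ⟨A₀, hA₀⟩ := eventually_atTop.1
    ((Real.isLittleO_pow_log_id_atTop (n := 2 * E)).bound hη)
  refine ⟨max A₀ (16 * 8 ^ E), (le_max_right _ _).trans' ?_, fun G b x hG hb hx => ?_⟩
  · nlinarith [one_le_pow₀ (n := E) (by norm_num : (1 : ℝ) ≤ 8)]
  set A := max A₀ (16 * 8 ^ E)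
  have hA16 : 16 * 8 ^ E ≤ A := le_max_right _ _
  have h8 : (1 : ℝ) ≤ 8 ^ E := one_le_pow₀ (by norm_num)
  have hlogG : 0 ≤ Real.log G := Real.log_nonneg hG
  set s := b + Real.log G with hs
  have hs₀ : 0 ≤ s := by positivity
  set y := x / G with hy
  have hG₀ : 0 < G := by linarith
  have hxy : x = y * G := by rw [hy, div_mul_cancel₀ _ hG₀.ne']
  have hyA : A * (1 + s) ^ (2 * E) ≤ y := by
    rw [hy, le_div_iff₀ hG₀, hs, ← add_assoc]
    exact hx
  have hA₁ : A ≤ y :=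
    (le_mul_of_one_le_right (by linarith) (one_le_pow₀ (by linarith))).trans hyA
  have hy16 : 16 ≤ y := by linarith
  have hlogy : 0 ≤ Real.log y := Real.log_nonneg (by linarith)
  have hlogx : Real.log x = Real.log y + Real.log G := by
    rw [hxy, Real.log_mul (by linarith) hG₀.ne']
  have h1 : Real.log y ^ (2 * E) ≤ 1 / (8 * 8 ^ E) * y := by
    have := hA₀ y ((le_max_left _ _).trans hA₁)
    rwa [Real.norm_eq_abs, id, Real.norm_eq_abs, abs_of_nonneg (by linarith : 0 ≤ y),
      abs_of_nonneg (by positivity)] at this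
  have h2 : s ^ (2 * E) ≤ 1 / (16 * 8 ^ E) * y := by
    rw [one_div_mul_eq_div, le_div_iff₀ (by positivity), mul_comm]
    refine le_trans ?_ hyA
    gcongr
    linarith
  have h3 : 2 * (Real.log x + b) * Real.log x ≤ 2 * (Real.log y + s) ^ 2 := by
    rw [hlogx]
    have : (Real.log y + Real.log G + b) * (Real.log y + Real.log G) ≤
      (Real.log y + s) * (Real.log y + s) :=
      mul_le_mul (by linarith) (by linarith) (by linarith) (by linarith)
    nlinarith
  have h4 : (2 * (Real.log x + b) * Real.log x) ^ E ≤ 3 / 16 * y := by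
    calc (2 * (Real.log x + b) * Real.log x) ^ E ≤ (2 * (Real.log y + s) ^ 2) ^ E := by
          have : 0 ≤ Real.log x := by rw [hlogx]; positivity
          gcongr
      _ = 2 ^ E * (Real.log y + s) ^ (2 * E) := by rw [mul_pow, ← pow_mul]
      _ ≤ 2 ^ E * (2 ^ (2 * E - 1) * (Real.log y ^ (2 * E) + s ^ (2 * E))) := by
          gcongr
          exact add_pow_le hlogy hs₀ _
      _ ≤ 2 ^ E * (2 ^ (2 * E) * (1 / (8 * 8 ^ E) * y + 1 / (16 * 8 ^ E) * y)) := by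
          gcongr
          · norm_num
          · omega
      _ = 3 / 16 * y := by
          have : (8 : ℝ) ^ E = 2 ^ E * 2 ^ (2 * E) := by
            rw [pow_mul, ← mul_pow]
            norm_num
          rw [this]
          field_simp
          norm_num
  rw [hxy] at *
  nlinarith

end GapSum

end ModalBandit

/-! ### Identification of the top arm -/

theorem mainTheorem4 (D : ℕ) (hD : 1 ≤ D) :
    ∃ P : MvPolynomial (Fin 2) ℝ, ∀ L : NNReal,
      ∃ N : (EuclideanSpace ℝ (Fin D) → ℝ) → ℕ,
        ∀ (K : ℕ) (hK : 2 ≤ K)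
          (r : EuclideanSpace ℝ (Fin D) → ℝ)
          (_ : ∀ x, r x ∈ Set.Icc (0 : ℝ) 1) (_ : LipschitzWith L r)
          (f : Fin K → EuclideanSpace ℝ (Fin D) → ℝ)
          (_ : ∀ i, ModalBandit.IsUnimodalDensity (f i))
          (θ : Fin K → ℝ) (_ : ∀ i, θ i = r (ModalBandit.modeOf (f i)))
          (_ : Antitone θ) (_ : θ ⟨1, by omega⟩ < θ ⟨0, by omega⟩)
          (Ω : Type*) [MeasurableSpace Ω] (μ : Measure Ω) [IsProbabilityMeasure μ]
          (X : Fin K → ℕ → Ω → EuclideanSpace ℝ (Fin D))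
          (_ : ∀ i j, Measurable (X i j))
          (_ : ∀ i j, μ.map (X i j) = ModalBandit.lawOf (f i))
          (_ : iIndepFun (fun p : Fin K × ℕ => X p.1 p.2) μ)
          (δ : ℝ) (_ : 0 < δ) (_ : δ < 1) (n : ℕ)
          (I : ℕ → Ω → Fin K) (_ : ∀ t, Measurable (I t))
          (_ : ∀ᵐ ω ∂μ, ModalBandit.IsUCBRun r n (δ / n) (fun i j => X i j ω) (fun t => I t ω)),
          (∀ i, N (f i) ≤ n) →
          MvPolynomial.eval
              ![Real.log (1 / δ), Real.log (ModalBandit.gapSum D θ ⟨0, by omega⟩)] P *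
            ModalBandit.gapSum D θ ⟨0, by omega⟩ ≤ n →
          1 - δ ≤ μ.real {ω | ∀ i : Fin K, i ≠ ⟨0, by omega⟩ →
            ModalBandit.pulls (fun t => I t ω) i n <
              ModalBandit.pulls (fun t => I t ω) ⟨0, by omega⟩ n} := by
  obtain ⟨A, hA2, hA⟩ := ModalBandit.exists_polynomial_horizon (4 + D)
  refine ⟨MvPolynomial.C A * (1 + MvPolynomial.X 0 + MvPolynomial.X 1) ^ (2 * (4 + D)),
    fun L => ?_⟩
  -- the threshold is chosen so that `log n` exceeds the constant `ℓ₀` of the density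
  have hN : ∀ f : EuclideanSpace ℝ (Fin D) → ℝ, ∃ N : ℕ, ModalBandit.IsUnimodalDensity f →
      2 ≤ N ∧ ∀ n : ℕ, N ≤ n → ∀ r : EuclideanSpace ℝ (Fin D) → ℝ,
        (∀ x, r x ∈ Set.Icc (0 : ℝ) 1) → LipschitzWith L r → ∀ ℓ, Real.log n ≤ ℓ →
        ∀ s : ℕ, 2 ≤ s → (Measure.pi fun _ => ModalBandit.lawOf f)
          {S : Fin s → EuclideanSpace ℝ (Fin D) | ∃ x, ModalBandit.IsModeEstimate S x ∧
            ℓ * Real.log s / (s : ℝ) ^ ((1 : ℝ) / (4 + D)) <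
              |r x - r (ModalBandit.modeOf f)|} ≤
          ENNReal.ofReal (3 * s * Real.exp (-(5 * ℓ))) := by
    intro f
    by_cases hf : ModalBandit.IsUnimodalDensity f
    swap
    · exact ⟨0, fun h => absurd h hf⟩
    obtain ⟨ℓ₀, hℓ₀⟩ := hf.exists_pi_score_band_le hD L
    obtain ⟨N, hN⟩ := eventually_atTop.1
      ((Real.tendsto_log_atTop.comp tendsto_natCast_atTop_atTop).eventually_ge_atTop ℓ₀)
    exact ⟨max 2 N, fun _ => ⟨le_max_left _ _, fun n hn r hr hL ℓ hℓ =>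
      hℓ₀ r hr hL ℓ ((hN n ((le_max_right _ _).trans hn)).trans hℓ)⟩⟩
  choose N hN using hN
  refine ⟨N, ?_⟩
  intro K hK r hr hL f hf θ hθ hanti hθ01 Ω _ μ _ X hX hlaw hind δ hδ₀ hδ₁ n I hI hrun hNn hPn
  set a : Fin K := ⟨0, by omega⟩
  have hlt : ∀ i, i ≠ a → θ i < θ a := fun i hi =>
    (hanti (Fin.mk_le_of_le_val (Nat.one_le_iff_ne_zero.2 fun h => hi (Fin.ext h)))).trans_lt hθ01
  set G := ModalBandit.gapSum D θ a
  have hKG : (K : ℝ) ≤ G + 1 :=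
    ModalBandit.le_gapSum_add_one (fun i => hθ i ▸ hr _) hlt
  have hK2 : (2 : ℝ) ≤ K := by exact_mod_cast hK
  have hG1 : 1 ≤ G := by linarith
  have hb : 0 ≤ Real.log (1 / δ) := Real.log_nonneg ((one_le_div hδ₀).2 hδ₁.le)
  simp only [map_mul, map_pow, map_add, map_one, MvPolynomial.eval_C, MvPolynomial.eval_X,
    Matrix.cons_val_zero, Matrix.cons_val_one] at hPn
  have hhor := hA G _ n hG1 hb hPn
  have hn2 : 2 ≤ n := ((hN (f a)) (hf a)).1.trans (hNn a)
  have hn₀ : (2 : ℝ) ≤ n := by exact_mod_cast hn2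
  have hKn : K ≤ n := by
    have h1 : 2 * G ≤ n := by
      refine le_trans ?_ hPn
      have : 1 ≤ (1 + Real.log (1 / δ) + Real.log G) ^ (2 * (4 + D)) :=
        one_le_pow₀ (by linarith [Real.log_nonneg hG1])
      gcongr
      nlinarith
    exact_mod_cast (by linarith : (K : ℝ) ≤ n)
  have hℓ : Real.log (1 / (δ / n)) = Real.log n + Real.log (1 / δ) := by
    rw [one_div_div, div_eq_mul_one_div, Real.log_mul (by positivity) (by positivity)]
  have hbad := ModalBandit.measure_exists_band_lt_le (r := r) hX hlaw hind hδ₀ hδ₁ hn2 hKn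
    fun i => (hN (f i) (hf i)).2 n (hNn i) r hr hL _ (by rw [hℓ]; linarith)
  set bad := {ω | ∃ i, ∃ s ∈ Finset.Icc 2 n, ∃ x,
    ModalBandit.IsModeEstimate (fun j : Fin s => X i j ω) x ∧
      Real.log (1 / (δ / n)) * Real.log s / (s : ℝ) ^ ((1 : ℝ) / (4 + D)) <
        |r x - r (ModalBandit.modeOf (f i))|}
  set good := {ω | ∀ i : Fin K, i ≠ a → ModalBandit.pulls (fun t => I t ω) i n <
    ModalBandit.pulls (fun t => I t ω) a n}
  have hsub : goodᶜ ≤ᵐ[μ] bad := by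
    filter_upwards [hrun] with ω hω hnot
    by_contra hnbad
    refine hnot fun i hi => ?_
    -- each inverse power of a gap is at least `1`, which absorbs the additive `2`
    have hpulls : ∀ i ∈ Finset.univ.erase a, (ModalBandit.pulls (fun t => I t ω) i n : ℝ) ≤
        ((2 * (Real.log n + Real.log (1 / δ)) * Real.log n) ^ (4 + D) + 2) *
          ((θ a - θ i) ^ (4 + D))⁻¹ := by
      intro i hi
      have hΔ : 0 < θ a - θ i := sub_pos.2 (hlt i (Finset.ne_of_mem_erase hi))
      have hΔ1 : 1 ≤ ((θ a - θ i) ^ (4 + D))⁻¹ := by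
        refine (one_le_inv₀ (by positivity)).2 (pow_le_one₀ hΔ.le ?_)
        rw [hθ, hθ]
        linarith [(hr (ModalBandit.modeOf (f a))).2, (hr (ModalBandit.modeOf (f i))).1]
      have := hω.pulls_le (θ := θ) (a := a) (i := i)
        (by rw [hℓ]; linarith [Real.log_nonneg (by linarith : (1 : ℝ) ≤ n)])
        (fun i s hs x hx => ?_) (sub_pos.1 hΔ)
      · rw [hℓ] at this
        linarith
      · by_contra! hlt
        exact hnbad ⟨i, s, hs, x, hx, by rwa [← hθ]⟩
    have hrest : ∑ i ∈ Finset.univ.erase a, (ModalBandit.pulls (fun t => I t ω) i n : ℝ) <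
        n / 2 := by
      refine (Finset.sum_le_sum hpulls).trans_lt ?_
      rwa [← Finset.mul_sum]
    have htotal : (ModalBandit.pulls (fun t => I t ω) a n : ℝ) +
        ∑ i ∈ Finset.univ.erase a, (ModalBandit.pulls (fun t => I t ω) i n : ℝ) = n := by
      rw [Finset.add_sum_erase _ (fun i => (ModalBandit.pulls (fun t => I t ω) i n : ℝ))
        (Finset.mem_univ a)]
      exact_mod_cast ModalBandit.sum_pulls (fun t => I t ω) n
    have hi' : (ModalBandit.pulls (fun t => I t ω) i n : ℝ) ≤
        ∑ i ∈ Finset.univ.erase a, (ModalBandit.pulls (fun t => I t ω) i n : ℝ) :=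
      Finset.single_le_sum (f := fun i => (ModalBandit.pulls (fun t => I t ω) i n : ℝ))
        (fun _ _ => Nat.cast_nonneg _) (Finset.mem_erase.2 ⟨hi, Finset.mem_univ i⟩)
    exact_mod_cast (by linarith : (ModalBandit.pulls (fun t => I t ω) i n : ℝ) <
      ModalBandit.pulls (fun t => I t ω) a n)
  have hcompl : μ.real goodᶜ ≤ δ :=
    ENNReal.toReal_le_of_le_ofReal hδ₀.le ((measure_mono_ae hsub).trans hbad)
  have hunion : μ.real (good ∪ goodᶜ) ≤ μ.real good + μ.real goodᶜ := measureReal_union_le _ _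
  rw [Set.union_compl_self, probReal_univ] at hunion
  linarith
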